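/- Let $\mathbb{D}=\{z\in\mathbb{C}:|z|<1\}$ and let $f$ be a normalized convex mapping of $\mathbb{D}$, that is, $f$ is holomorphic and injective in $\mathbb{D}$, $f(0)=0$, $f'(0)=1$, and $f(\mathbb{D})$ is convex. Let $a_2=f''(0)/2$ be its second Taylor coefficient. Suppose that there is a point $\zeta\in\partial\mathbb{D}$ at which $f$ has a finite boundary value $f(\zeta)=\lim_{z\to\zeta,\ z\in\mathbb{D}}f(z)\in\mathbb{C}$ with $$\mathrm{Re}\{a_2 f(\zeta)\}=-\tfrac12 .$$ Then $f(\mathbb{D})$ is either an open halfplane or an open infinite convex sector, that is, a set of the form $\{p+re^{i(\theta+\varphi)}: r>0,\ |\varphi|<\alpha/2\}$ with $p\in\mathbb{C}$, $\theta\in\mathbb{R}$ and $0<\alpha<\pi$. -/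

import Mathlib

/-- The class of normalized convex mappings of the unit disk: `f` is holomorphic and univalent in
the open unit disk, `f 0 = 0`, `f' 0 = 1`, and the image of the disk is convex. -/
structure IsNormalizedConvexMapping (f : ℂ → ℂ) : Prop where
  holomorphic : DifferentiableOn ℂ f (Metric.ball 0 1)
  univalent : Set.InjOn f (Metric.ball 0 1)
  map_zero : f 0 = 0
  deriv_zero : deriv f 0 = 1
  convex_image : Convex ℝ (f '' Metric.ball 0 1)

/-- The `n`-th Taylor coefficient of `f` at the origin. -/
noncomputable def taylorCoeff (n : ℕ) (f : ℂ → ℂ) : ℂ :=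
  iteratedDeriv n f 0 / (n.factorial : ℂ)

/-- `f` has the finite boundary value `w` at the boundary point `ζ` of the unit disk: `f z` tends
to `w` as `z` tends to `ζ` inside the disk. -/
def HasFiniteBoundaryValue (f : ℂ → ℂ) (ζ w : ℂ) : Prop :=
  Filter.Tendsto f (nhdsWithin ζ (Metric.ball 0 1)) (nhds w)

/-- `S` is an open halfplane, with inner normal `u`. -/
def IsOpenHalfplane (S : Set ℂ) : Prop :=
  ∃ (u : ℂ) (c : ℝ), u ≠ 0 ∧ S = {w : ℂ | c < (starRingEnd ℂ u * w).re}

/-- `S` is an open infinite convex sector, with vertex `p`, axis in the direction `exp (iθ)` and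
opening angle `α`, where `0 < α < π`. -/
def IsInfiniteConvexSector (S : Set ℂ) : Prop :=
  ∃ (p : ℂ) (θ α : ℝ), 0 < α ∧ α < Real.pi ∧
    S = {w : ℂ | ∃ r φ : ℝ, 0 < r ∧ |φ| < α / 2 ∧
      w = p + (r : ℂ) * Complex.exp (((θ + φ : ℝ) : ℂ) * Complex.I)}

/-! The conformal radius of the convex domain Ω = f(𝔻) is concave along segments. Indeed, a convex
combination of two univalent parametrizations of Ω with positive derivative at 0 is subordinate to
the one centred at the combined point, so `subordinate_schwarz` bounds its derivative. Let R(t) be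
the conformal radius at tw, 0 ≤ t < 1. Then R ≥ 0, R(0) = 1 and R'(0) = 2 Re(a₂w) = -1, the extremal
slope, which forces R(t) = 1 - t (`eq_one_sub_of_concaveOn`). Equality in Schwarz' lemma then makes
the parametrizations H t centred at tw affine in t, say H t = f + t k. As t → 1, the limit f + k
stays on one side of a supporting line at w and takes the value w at 0, so it is constant by the
open mapping theorem (`eq_contraction_of_affine_family`). Hence Ω = (1 - t)Ω + tw for all such t: Ω
is an open convex cone with vertex w, so a halfplane or a sector. -/

open Metric Set Filter Topology

/-! ### Univalent functions, subordination and disk automorphisms -/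

/-- A univalent function on the unit disk has a holomorphic inverse, and its derivative has no
zero. -/
theorem exists_inverse_of_univalent {F : ℂ → ℂ} (hF : DifferentiableOn ℂ F (ball 0 1))
    (hi : InjOn F (ball 0 1)) :
    IsOpen (F '' ball 0 1) ∧ ∃ g : ℂ → ℂ, (∀ z ∈ ball (0 : ℂ) 1, g (F z) = z) ∧
      ∀ z ∈ ball (0 : ℂ) 1, deriv F z ≠ 0 ∧ HasDerivAt g (deriv F z)⁻¹ (F z) := by
  have hFa : AnalyticOnNhd ℂ F (ball 0 1) := hF.analyticOnNhd isOpen_ball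
  have hnc : ∀ s ⊆ ball (0 : ℂ) 1, IsOpen s → IsOpen (F '' s) := by
    refine (hFa.is_constant_or_isOpen (convex_ball 0 1).isPreconnected).resolve_left ?_
    rintro ⟨c, hc⟩
    have h0 : (0 : ℂ) ∈ ball (0 : ℂ) 1 := by simp
    have h1 : (1 / 2 : ℂ) ∈ ball (0 : ℂ) 1 := by simp; norm_num
    have := hi h0 h1 ((hc 0 h0).trans (hc _ h1).symm)
    norm_num at this
  refine ⟨hnc _ subset_rfl isOpen_ball, Function.invFunOn F (ball 0 1),
    fun z hz => hi.leftInvOn_invFunOn hz, ?_⟩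
  set g := Function.invFunOn F (ball 0 1) with hg
  have hgl : ∀ z ∈ ball (0 : ℂ) 1, g (F z) = z := fun z hz => hi.leftInvOn_invFunOn hz
  have hgc : ∀ z ∈ ball (0 : ℂ) 1, ContinuousAt g (F z) := by
    intro z hz
    rw [ContinuousAt, hgl z hz]
    intro U hU
    obtain ⟨V, hVU, hV, hzV⟩ := _root_.mem_nhds_iff.1 (inter_mem hU (isOpen_ball.mem_nhds hz))
    have : F '' V ∈ 𝓝 (F z) :=
      (hnc V (fun x hx => (hVU hx).2) hV).mem_nhds (mem_image_of_mem _ hzV)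
    rw [mem_map]
    filter_upwards [this]
    rintro _ ⟨x, hx, rfl⟩
    simpa [hgl x (hVU hx).2] using (hVU hx).1
  have hr : ∀ z ∈ ball (0 : ℂ) 1, ∀ᶠ y in 𝓝 (F z), F (g y) = y := by
    intro z hz
    filter_upwards [(hnc _ subset_rfl isOpen_ball).mem_nhds (mem_image_of_mem F hz)]
    rintro _ ⟨x, hx, rfl⟩
    rw [hgl x hx]
  have hFd : ∀ z ∈ ball (0 : ℂ) 1, HasDerivAt F (deriv F z) z := fun z hz =>
    (hFa z hz).differentiableAt.hasDerivAt
  have hgd : ∀ z ∈ ball (0 : ℂ) 1, deriv F z ≠ 0 → HasDerivAt g (deriv F z)⁻¹ (F z) := by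
    intro z hz h
    exact HasDerivAt.of_local_left_inverse (hgc z hz) (by rw [hgl z hz]; exact hFd z hz) h (hr z hz)
  -- Zeros of F' are isolated, so g is holomorphic on a punctured neighbourhood of F z and
  -- continuous at F z. The singularity is removable, and the chain rule for g ∘ F = id excludes F'
  -- z = 0.
  have hne : ∀ z ∈ ball (0 : ℂ) 1, deriv F z ≠ 0 := by
    intro z hz
    have hpun : ∀ᶠ x in 𝓝[≠] z, deriv F x ≠ 0 := by
      refine (hFa z hz).deriv.eventually_eq_zero_or_eventually_ne_zero.resolve_left fun h => ?_
      obtain ⟨r, hr0, hrz⟩ := Metric.mem_nhds_iff.1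
        (inter_mem h (isOpen_ball.mem_nhds hz))
      have hconst : ∀ x ∈ ball z r, F x = F z := fun x hx =>
        isOpen_ball.is_const_of_deriv_eq_zero (convex_ball z r).isPreconnected
          (fun y hy => (hFd y (hrz hy).2).differentiableAt.differentiableWithinAt)
          (fun y hy => (hrz hy).1) hx (mem_ball_self hr0)
      have hx : z + (r / 2 : ℝ) ∈ ball z r := by
        rw [mem_ball, dist_eq_norm, add_sub_cancel_left, Complex.norm_real, Real.norm_eq_abs,
          abs_of_pos (by positivity)]
        linarith
      have := hi (hrz hx).2 hz (hconst _ hx)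
      simp only [add_eq_left, Complex.ofReal_eq_zero] at this
      linarith
    have hga : AnalyticAt ℂ g (F z) := by
      refine Complex.analyticAt_of_differentiable_on_punctured_nhds_of_continuousAt ?_ (hgc z hz)
      have ht : Tendsto g (𝓝[≠] (F z)) (𝓝[≠] z) := by
        refine tendsto_nhdsWithin_iff.2 ⟨?_, ?_⟩
        · have := hgc z hz
          rw [ContinuousAt, hgl z hz] at this
          exact this.mono_left nhdsWithin_le_nhds
        · filter_upwards [self_mem_nhdsWithin, (hr z hz).filter_mono nhdsWithin_le_nhds] with y h1 h2
          intro h3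
          rw [mem_singleton_iff] at h3
          rw [h3] at h2
          exact h1 h2.symm
      filter_upwards [ht.eventually hpun, ht.eventually
        ((isOpen_ball.eventually_mem hz).filter_mono nhdsWithin_le_nhds),
        (hr z hz).filter_mono nhdsWithin_le_nhds] with y h1 h2 h3
      have := (hgd _ h2 h1).differentiableAt
      rwa [h3] at this
    intro h0
    have h1 : HasDerivAt (g ∘ F) (deriv g (F z) * deriv F z) z :=
      hga.differentiableAt.hasDerivAt.comp z (hFd z hz)
    have h2 : HasDerivAt (g ∘ F) 1 z := by
      refine (hasDerivAt_id z).congr_of_eventuallyEq ?_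
      filter_upwards [isOpen_ball.mem_nhds hz] with x hx using hgl x hx
    have := h1.unique h2
    simp [h0] at this
  exact fun z hz => ⟨hne z hz, hgd z hz (hne z hz)⟩

/-- Schwarz' lemma for functions subordinate to a univalent function. -/
theorem subordinate_schwarz {F G : ℂ → ℂ} (hF : DifferentiableOn ℂ F (ball 0 1))
    (hi : InjOn F (ball 0 1)) (hG : DifferentiableOn ℂ G (ball 0 1))
    (hm : MapsTo G (ball 0 1) (F '' ball 0 1)) (h0 : G 0 = F 0) :
    ‖deriv G 0‖ ≤ ‖deriv F 0‖ ∧ (deriv G 0 = deriv F 0 → EqOn G F (ball 0 1)) := by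
  obtain ⟨-, g, hgl, hg⟩ := exists_inverse_of_univalent hF hi
  have hz : (0 : ℂ) ∈ ball (0 : ℂ) 1 := by simp
  have hFz := hg 0 hz
  have hFg : ∀ z ∈ ball (0 : ℂ) 1, F (g (G z)) = G z := by
    intro z hz
    obtain ⟨x, hx, h⟩ := hm hz
    rw [← h, hgl x hx]
  -- Schwarz' lemma is applied to g ∘ G, a self-map of the disk fixing 0.
  have hmaps : MapsTo (g ∘ G) (ball 0 1) (ball 0 1) := by
    intro z hz
    obtain ⟨x, hx, h⟩ := hm hz
    rw [Function.comp_apply, ← h, hgl x hx]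
    exact hx
  have hd : DifferentiableOn ℂ (g ∘ G) (ball 0 1) := by
    intro z hz
    obtain ⟨x, hx, h⟩ := hm hz
    refine DifferentiableAt.comp_differentiableWithinAt z ?_ (hG z hz)
    rw [← h]
    exact (hg x hx).2.differentiableAt
  have hc : (g ∘ G) 0 = 0 := by simp [h0, hgl 0 hz]
  have hmc : MapsTo (g ∘ G) (ball 0 1) (closedBall ((g ∘ G) 0) 1) := by
    rw [hc]; exact hmaps.mono_right ball_subset_closedBall
  have hder : deriv (g ∘ G) 0 = (deriv F 0)⁻¹ * deriv G 0 := by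
    refine HasDerivAt.deriv (HasDerivAt.comp 0 ?_ ?_)
    · rw [h0]; exact hFz.2
    · exact (hG.differentiableAt (isOpen_ball.mem_nhds hz)).hasDerivAt
  constructor
  · have := Complex.norm_deriv_le_one_of_mapsTo_ball hd hmc one_pos
    rw [hder, norm_mul, norm_inv, inv_mul_le_one₀ (norm_pos_iff.2 hFz.1)] at this
    exact this
  · intro h z hz'
    rw [h, inv_mul_cancel₀ hFz.1] at hder
    have := Complex.affine_of_mapsTo_ball_of_norm_dslope_eq_div hd hmc hz
      (by rw [dslope_same, hder]; simp) hz'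
    rw [dslope_same, hder, hc] at this
    rw [← hFg z hz']
    congr 1
    simpa using this

/-- Precomposition of a univalent function with the disk automorphism carrying `0` to `a`. -/
theorem exists_koebe_transform {F : ℂ → ℂ} (hF : DifferentiableOn ℂ F (ball 0 1))
    (hi : InjOn F (ball 0 1)) {a : ℂ} (ha : a ∈ ball (0 : ℂ) 1) :
    ∃ H : ℂ → ℂ, DifferentiableOn ℂ H (ball 0 1) ∧ InjOn H (ball 0 1) ∧
      H '' ball 0 1 = F '' ball 0 1 ∧ H 0 = F a ∧
      deriv H 0 = (((1 - ‖a‖ ^ 2) * ‖deriv F a‖ : ℝ) : ℂ) := by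
  obtain ⟨-, g, hgl, hg⟩ := exists_inverse_of_univalent hF hi
  have hFa := (hg a ha).1
  -- The rotation ε makes the derivative at 0 positive, so that derivatives of different transforms
  -- add without cancellation.
  obtain ⟨ε, hε1, hε⟩ : ∃ ε : ℂ, ‖ε‖ = 1 ∧ deriv F a * ε = ‖deriv F a‖ := by
    refine ⟨‖deriv F a‖ / deriv F a, ?_, mul_div_cancel₀ _ hFa⟩
    rw [norm_div, Complex.norm_real, norm_norm, div_self (norm_ne_zero_iff.2 hFa)]
  have hε0 : ε ≠ 0 := by rintro rfl; simp at hε1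
  rw [mem_ball_zero_iff] at ha
  have key : ∀ b z : ℂ, ‖b‖ < 1 → ‖z‖ < 1 →
      1 + (starRingEnd ℂ) b * z ≠ 0 ∧ ‖(z + b) / (1 + (starRingEnd ℂ) b * z)‖ < 1 := by
    intro b z hb hz
    have hne : 1 + (starRingEnd ℂ) b * z ≠ 0 := by
      intro h
      have h1 : ‖(starRingEnd ℂ) b * z‖ = 1 := by
        rw [eq_neg_of_add_eq_zero_right h]; simp
      rw [norm_mul, RCLike.norm_conj] at h1
      nlinarith [norm_nonneg b, norm_nonneg z]
    refine ⟨hne, ?_⟩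
    rw [norm_div, div_lt_one (norm_pos_iff.2 hne), ← sq_lt_sq₀ (norm_nonneg _) (norm_nonneg _),
      Complex.sq_norm, Complex.sq_norm]
    have hb' : Complex.normSq b < 1 := by rw [← Complex.sq_norm]; nlinarith [norm_nonneg b]
    have hz' : Complex.normSq z < 1 := by rw [← Complex.sq_norm]; nlinarith [norm_nonneg z]
    -- |1 + b̄z|² - |z + b|² = (1 - |b|²)(1 - |z|²).
    have := mul_pos (sub_pos.2 hb') (sub_pos.2 hz')
    simp only [Complex.normSq_apply, Complex.add_re, Complex.add_im, Complex.mul_re,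
      Complex.mul_im, Complex.conj_re, Complex.conj_im, Complex.one_re, Complex.one_im] at this ⊢
    nlinarith
  set φ : ℂ → ℂ := fun z => (ε * z + a) / (1 + (starRingEnd ℂ) a * (ε * z)) with hφ
  set ψ : ℂ → ℂ := fun z => ε⁻¹ * ((z + -a) / (1 + (starRingEnd ℂ) (-a) * z)) with hψ
  have hεz : ∀ z : ℂ, ‖z‖ < 1 → ‖ε * z‖ < 1 := fun z hz => by rwa [norm_mul, hε1, one_mul]
  have hφm : MapsTo φ (ball 0 1) (ball 0 1) := by
    intro z hz
    rw [mem_ball_zero_iff] at hz ⊢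
    exact (key a _ ha (hεz z hz)).2
  have hψm : MapsTo ψ (ball 0 1) (ball 0 1) := by
    intro z hz
    rw [mem_ball_zero_iff] at hz ⊢
    rw [hψ]
    simp only [norm_mul, norm_inv, hε1, inv_one, one_mul]
    exact (key (-a) z (by simpa using ha) hz).2
  have hψφ : ∀ z ∈ ball (0 : ℂ) 1, ψ (φ z) = z := by
    intro z hz
    have h1 := (key a _ ha (hεz z (mem_ball_zero_iff.1 hz))).1
    have h2 := (key (-a) _ (by simpa using ha) (mem_ball_zero_iff.1 (hφm hz))).1
    simp only [hψ]
    rw [inv_mul_eq_iff_eq_mul₀ hε0, div_eq_iff h2]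
    have hq : φ z * (1 + (starRingEnd ℂ) a * (ε * z)) = ε * z + a := div_mul_cancel₀ _ h1
    rw [map_neg]
    linear_combination hq
  have hφψ : ∀ z ∈ ball (0 : ℂ) 1, φ (ψ z) = z := by
    intro z hz
    have h1 := (key (-a) _ (by simpa using ha) (mem_ball_zero_iff.1 hz)).1
    have h2 := (key a _ ha (hεz _ (mem_ball_zero_iff.1 (hψm hz)))).1
    simp only [hφ]
    rw [div_eq_iff h2]
    have hq : ε * ψ z * (1 + (starRingEnd ℂ) (-a) * z) = z + -a := by
      simp only [hψ, mul_inv_cancel_left₀ hε0]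
      exact div_mul_cancel₀ _ h1
    rw [map_neg] at hq
    linear_combination hq
  have hφd : ∀ z ∈ ball (0 : ℂ) 1, DifferentiableAt ℂ φ z := by
    intro z hz
    have h1 := (key a _ ha (hεz z (mem_ball_zero_iff.1 hz))).1
    exact DifferentiableAt.div (by fun_prop) (by fun_prop) h1
  have hz : (0 : ℂ) ∈ ball (0 : ℂ) 1 := by simp
  have hφ0 : φ 0 = a := by simp [hφ]
  refine ⟨F ∘ φ, hF.comp (fun z hz => (hφd z hz).differentiableWithinAt) hφm, ?_, ?_, ?_, ?_⟩
  · intro x hx y hy h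
    have := congrArg ψ (hi (hφm hx) (hφm hy) h)
    rwa [hψφ x hx, hψφ y hy] at this
  · rw [image_comp]
    congr 1
    exact Subset.antisymm hφm.image_subset fun z hz => ⟨ψ z, hψm hz, hφψ z hz⟩
  · rw [Function.comp_apply, hφ0]
  · have h1 : HasDerivAt φ (ε * (1 - (starRingEnd ℂ) a * a)) 0 := by
      have hn : HasDerivAt (fun z : ℂ => ε * z + a) ε 0 := by
        simpa using ((hasDerivAt_id (0 : ℂ)).const_mul ε).add_const a
      have hd : HasDerivAt (fun z : ℂ => 1 + (starRingEnd ℂ) a * (ε * z))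
          ((starRingEnd ℂ) a * ε) 0 := by
        simpa using (((hasDerivAt_id (0 : ℂ)).const_mul ε).const_mul ((starRingEnd ℂ) a)).const_add 1
      convert! hn.div hd (by simp) using 1
      simp
      ring
    have h2 : HasDerivAt F (deriv F a) (φ 0) := by
      rw [hφ0]
      exact (hF.differentiableAt (isOpen_ball.mem_nhds (by simpa using ha))).hasDerivAt
    rw [(h2.comp 0 h1).deriv, ← mul_assoc, hε, Complex.conj_mul']
    push_cast
    ring

/-! ### Open convex cones in the plane -/

/-- A bounded, open, order connected set of reals is an open interval. -/
theorem eq_Ioo_of_isOpen_of_ordConnected {J : Set ℝ} (ho : IsOpen J) (hc : J.OrdConnected)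
    (hne : J.Nonempty) (hb : BddBelow J) (ha : BddAbove J) : J = Ioo (sInf J) (sSup J) := by
  refine Subset.antisymm (fun x hx => ?_)
    (IsConnected.Ioo_csInf_csSup_subset ⟨hne, hc.isPreconnected⟩ hb ha)
  obtain ⟨ε, hε, hs⟩ := Metric.isOpen_iff.1 ho x hx
  have h1 : x - ε / 2 ∈ J := hs (by simp [abs_of_pos hε, hε])
  have h2 : x + ε / 2 ∈ J := hs (by simp [abs_of_pos hε, hε])
  exact ⟨by linarith [csInf_le hb h1], by linarith [le_csSup ha h2]⟩

/-- An open convex cone with vertex `p ∉ S` is a halfplane or an infinite convex sector. -/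
theorem isOpenHalfplane_or_isInfiniteConvexSector {S : Set ℂ} {p : ℂ} (ho : IsOpen S)
    (hconv : Convex ℝ S) (hne : S.Nonempty) (hp : p ∉ S)
    (hcone : ∀ x ∈ S, ∀ r : ℝ, 0 < r → p + r * (x - p) ∈ S) :
    IsOpenHalfplane S ∨ IsInfiniteConvexSector S := by
  obtain ⟨L, hL⟩ := geometric_hahn_banach_open_point hconv ho hp
  -- θ₀ is the direction of steepest descent of L, so S lies within angle π/2 of θ₀ as seen from p.
  obtain ⟨θ₀, R, hR, hLre⟩ : ∃ θ₀ R : ℝ, 0 < R ∧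
      ∀ z : ℂ, L z = -R * (z * Complex.exp (-(θ₀ * Complex.I))).re := by
    set v : ℂ := -(L 1 + L Complex.I * Complex.I) with hv
    have hLv : ∀ z : ℂ, L z = z.re * L 1 + z.im * L Complex.I := by
      intro z
      conv_lhs => rw [← Complex.re_add_im z]
      have h1 : (z.re : ℂ) = z.re • (1 : ℂ) := by simp
      have h2 : (z.im : ℂ) * Complex.I = z.im • Complex.I := by simp
      rw [map_add, h1, h2, map_smul, map_smul, smul_eq_mul, smul_eq_mul]
    have hv0 : v ≠ 0 := by
      intro h
      obtain ⟨x, hx⟩ := hne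
      have h1 : L 1 = 0 := by simpa [hv] using congrArg Complex.re h
      have h2 : L Complex.I = 0 := by simpa [hv] using congrArg Complex.im h
      have := hL x hx
      rw [hLv x, hLv p, h1, h2] at this
      simp at this
    refine ⟨v.arg, ‖v‖, norm_pos_iff.2 hv0, fun z => ?_⟩
    have hvc := congrArg (starRingEnd ℂ) (Complex.norm_mul_exp_arg_mul_I v)
    rw [map_mul, Complex.conj_ofReal, ← Complex.exp_conj, map_mul, Complex.conj_ofReal,
      Complex.conj_I, mul_neg] at hvc
    have : -‖v‖ * (z * Complex.exp (-(v.arg * Complex.I))).re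
        = -(z * (starRingEnd ℂ) v).re := by
      rw [← hvc, neg_mul, ← Complex.re_ofReal_mul]
      congr 2; ring
    rw [this, hLv]
    simp [hv, Complex.mul_re]
    ring
  set e : ℝ → ℂ := fun θ => Complex.exp (((θ₀ + θ : ℝ) : ℂ) * Complex.I) with he
  have hec : Continuous e := by fun_prop
  have hadd : ∀ x y : ℂ, p + x ∈ S → p + y ∈ S → ∀ a b : ℝ, 0 < a → 0 < b →
      p + (a * x + b * y) ∈ S := by
    intro x y hx hy a b ha hb
    have h := hconv (hcone _ hx (2 * a) (by positivity)) (hcone _ hy (2 * b) (by positivity))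
      (a := 1 / 2) (b := 1 / 2) (by norm_num) (by norm_num) (by norm_num)
    convert h using 1
    simp only [add_sub_cancel_left, Complex.real_smul]
    push_cast
    ring
  have hsc : ∀ x : ℂ, ∀ r : ℝ, 0 < r → (p + r * x ∈ S ↔ p + x ∈ S) := by
    intro x r hr
    constructor
    · intro h
      have := hcone _ h r⁻¹ (by positivity)
      have hr' : (r : ℂ) ≠ 0 := by exact_mod_cast hr.ne'
      rwa [add_sub_cancel_left, Complex.ofReal_inv, inv_mul_cancel_left₀ hr'] at this
    · intro h
      simpa using hcone _ h r hr
  have hrep : ∀ x : ℂ, L x < L p → ∃ r θ : ℝ, 0 < r ∧ θ ∈ Ioo (-(Real.pi / 2)) (Real.pi / 2) ∧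
      x = p + r * e θ := by
    intro x hx
    set y := (x - p) * Complex.exp (-(θ₀ * Complex.I)) with hy
    have hy0 : 0 < y.re := by
      have h1 : L (x - p) < 0 := by rw [map_sub]; linarith
      rw [hLre] at h1
      nlinarith
    refine ⟨‖y‖, y.arg, ?_, ?_, ?_⟩
    · rw [norm_pos_iff]; rintro h; simp [h] at hy0
    · exact abs_lt.1 (Complex.abs_arg_lt_pi_div_two_iff.2 (Or.inl hy0))
    · have : (‖y‖ : ℂ) * e y.arg = x - p := by
        simp only [he, Complex.ofReal_add, add_mul, Complex.exp_add]
        rw [mul_left_comm, Complex.norm_mul_exp_arg_mul_I, hy, mul_left_comm, ← Complex.exp_add]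
        simp
      rw [this]; ring
  set J : Set ℝ := Ioo (-(Real.pi / 2)) (Real.pi / 2) ∩ {θ | p + e θ ∈ S} with hJ
  have hJo : IsOpen J := isOpen_Ioo.inter (ho.preimage (by fun_prop : Continuous fun θ => p + e θ))
  have hS : S = {x | ∃ r θ : ℝ, 0 < r ∧ θ ∈ J ∧ x = p + r * e θ} := by
    ext x
    constructor
    · intro hx
      obtain ⟨r, θ, hr, hθ, h⟩ := hrep x (hL x hx)
      exact ⟨r, θ, hr, ⟨hθ, (hsc _ r hr).1 (h ▸ hx)⟩, h⟩
    · rintro ⟨r, θ, hr, ⟨-, hθ⟩, rfl⟩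
      exact (hsc _ r hr).2 hθ
  have hJc : J.OrdConnected := by
    refine ⟨fun α hα γ hγ β hβ => ?_⟩
    refine ⟨⟨lt_of_lt_of_le hα.1.1 hβ.1, lt_of_le_of_lt hβ.2 hγ.1.2⟩, ?_⟩
    rcases eq_or_lt_of_le hβ.1 with rfl | h1
    · exact hα.2
    rcases eq_or_lt_of_le hβ.2 with rfl | h2
    · exact hγ.2
    have hlt : γ - α < Real.pi := by linarith [hα.1.1, hγ.1.2]
    have s1 := Real.sin_pos_of_pos_of_lt_pi (sub_pos.2 h1) (by linarith)
    have s2 := Real.sin_pos_of_pos_of_lt_pi (sub_pos.2 h2) (by linarith)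
    have s3 := Real.sin_pos_of_pos_of_lt_pi (x := γ - α) (by linarith) hlt
    have := hadd _ _ hα.2 hγ.2 _ _ s2 s1
    -- Since γ - α < π, this writes e β as a positive combination of e α and e γ.
    have hid : (Real.sin (γ - β) : ℂ) * e α + (Real.sin (β - α) : ℂ) * e γ
        = (Real.sin (γ - α) : ℂ) * e β := by
      have hs : ∀ x y : ℝ, Real.sin (x - y)
          = Real.sin (θ₀ + x) * Real.cos (θ₀ + y) - Real.cos (θ₀ + x) * Real.sin (θ₀ + y) := by
        intro x y
        rw [← Real.sin_sub]; congr 1; ring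
      rw [hs γ β, hs β α, hs γ α]
      simp only [he, Complex.exp_mul_I, ← Complex.ofReal_cos, ← Complex.ofReal_sin]
      push_cast
      ring
    rw [hid] at this
    exact (hsc _ _ s3).1 this
  have hJne : J.Nonempty := by
    obtain ⟨x, hx⟩ := hne
    rw [hS] at hx
    obtain ⟨r, θ, -, h, -⟩ := hx
    exact ⟨θ, h⟩
  have hbb : BddBelow J := ⟨-(Real.pi / 2), fun x hx => hx.1.1.le⟩
  have hba : BddAbove J := ⟨Real.pi / 2, fun x hx => hx.1.2.le⟩
  have hJI := eq_Ioo_of_isOpen_of_ordConnected hJo hJc hJne hbb hba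
  have ha : -(Real.pi / 2) ≤ sInf J := le_csInf hJne fun x hx => hx.1.1.le
  have hb : sSup J ≤ Real.pi / 2 := csSup_le hJne fun x hx => hx.1.2.le
  generalize sInf J = a at *
  generalize sSup J = b at *
  have hab : a < b := by
    obtain ⟨x, hx⟩ := hJne
    rw [hJI] at hx
    exact hx.1.trans hx.2
  -- As b - a ≤ π in any case, the second alternative pins both endpoints.
  rcases lt_or_ge (b - a) Real.pi with hlt | hge
  · right
    refine ⟨p, θ₀ + (a + b) / 2, b - a, by linarith, hlt, ?_⟩
    rw [hS, hJI]
    ext x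
    constructor
    · rintro ⟨r, θ, hr, hθ, rfl⟩
      refine ⟨r, θ - (a + b) / 2, hr, abs_lt.2 ⟨by linarith [hθ.1], by linarith [hθ.2]⟩, ?_⟩
      simp only [he]
      congr 5; ring
    · rintro ⟨r, φ, hr, hφ, rfl⟩
      rw [abs_lt] at hφ
      refine ⟨r, (a + b) / 2 + φ, hr, ⟨by linarith [hφ.1], by linarith [hφ.2]⟩, ?_⟩
      simp only [he]
      congr 5; ring
  · left
    obtain rfl : a = -(Real.pi / 2) := by linarith
    obtain rfl : b = Real.pi / 2 := by linarith
    refine ⟨Complex.exp (θ₀ * Complex.I), (starRingEnd ℂ (Complex.exp (θ₀ * Complex.I)) * p).re,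
      Complex.exp_ne_zero _, ?_⟩
    have hLe : ∀ z : ℂ, L z = -R * (starRingEnd ℂ (Complex.exp (θ₀ * Complex.I)) * z).re := by
      intro z
      rw [hLre, mul_comm z, ← Complex.exp_conj]
      simp
    have hiff : ∀ x, (starRingEnd ℂ (Complex.exp (θ₀ * Complex.I)) * p).re
        < (starRingEnd ℂ (Complex.exp (θ₀ * Complex.I)) * x).re ↔ L x < L p := by
      intro x
      rw [hLe, hLe]
      constructor <;> intro h <;> nlinarith
    ext x
    rw [mem_ofPred_eq, hiff]
    refine ⟨hL x, fun hx => ?_⟩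
    obtain ⟨r, θ, hr, hθ, rfl⟩ := hrep x hx
    rw [hS, hJI]
    exact ⟨r, θ, hr, hθ, rfl⟩

/-! ### Boundary values -/

/-- A boundary value of a univalent function is not attained. -/
theorem boundary_value_notMem_image {f : ℂ → ℂ} (hf : DifferentiableOn ℂ f (ball 0 1))
    (hi : InjOn f (ball 0 1)) {ζ w : ℂ} (hζ : ζ ∈ sphere (0 : ℂ) 1)
    (hw : HasFiniteBoundaryValue f ζ w) : w ∉ f '' ball 0 1 := by
  rintro ⟨b, hb, rfl⟩
  obtain ⟨-, g, hgl, hg⟩ := exists_inverse_of_univalent hf hi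
  have hcl : ζ ∈ closure (ball (0 : ℂ) 1) := by
    rw [closure_ball _ one_ne_zero]
    exact sphere_subset_closedBall hζ
  have : (𝓝[ball 0 1] ζ).NeBot := mem_closure_iff_nhdsWithin_neBot.1 hcl
  have h1 : Tendsto (fun z => g (f z)) (𝓝[ball 0 1] ζ) (𝓝 b) := by
    have := (hg b hb).2.continuousAt.tendsto.comp hw
    rwa [hgl b hb] at this
  have h2 : Tendsto (fun z => g (f z)) (𝓝[ball 0 1] ζ) (𝓝 ζ) := by
    refine (tendsto_nhdsWithin_of_tendsto_nhds tendsto_id).congr' ?_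
    filter_upwards [self_mem_nhdsWithin] with z hz using (hgl z hz).symm
  have := tendsto_nhds_unique h1 h2
  rw [mem_sphere_zero_iff_norm] at hζ
  rw [mem_ball_zero_iff, this] at hb
  linarith

/-- A boundary value lies in the closure of the image. -/
theorem boundary_value_mem_closure_image {f : ℂ → ℂ} {ζ w : ℂ} (hζ : ζ ∈ sphere (0 : ℂ) 1)
    (hw : HasFiniteBoundaryValue f ζ w) : w ∈ closure (f '' ball 0 1) := by
  have hcl : ζ ∈ closure (ball (0 : ℂ) 1) := by
    rw [closure_ball _ one_ne_zero]
    exact sphere_subset_closedBall hζ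
  have : (𝓝[ball 0 1] ζ).NeBot := mem_closure_iff_nhdsWithin_neBot.1 hcl
  refine mem_closure_of_tendsto hw ?_
  filter_upwards [self_mem_nhdsWithin] with z hz using mem_image_of_mem f hz

/-! ### Extremal conformal radius along a ray -/

/-- A function on `[0, 1)` that is nonnegative, concave, equal to `1` at `0` and with derivative
`-1` there is `t ↦ 1 - t`. -/
theorem eq_one_sub_of_concaveOn {R : ℝ → ℝ} (hc : ConcaveOn ℝ (Ico 0 1) R)
    (hn : ∀ t ∈ Ico (0 : ℝ) 1, 0 ≤ R t) (h0 : R 0 = 1) (hd : HasDerivAt R (-1) 0) :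
    ∀ t ∈ Ico (0 : ℝ) 1, R t = 1 - t := by
  intro t ht
  have h0m : (0 : ℝ) ∈ Ico (0 : ℝ) 1 := by simp
  apply le_antisymm
  -- Upper bound: a concave function lies below its tangent at 0.
  · have hφ : HasDerivAt (fun l : ℝ => R (l * t)) (-1 * t) 0 := by
      have h1 : HasDerivAt (fun l : ℝ => l * t) t 0 := by
        simpa using (hasDerivAt_id (0 : ℝ)).mul_const t
      exact HasDerivAt.comp (h₂ := R) 0 (by simpa using hd) h1
    have hlim := hφ.tendsto_slope_zero_right
    have : R t - 1 ≤ -1 * t := by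
      refine ge_of_tendsto hlim ?_
      filter_upwards [Ioo_mem_nhdsGT (zero_lt_one (α := ℝ))] with l hl
      have := hc.2 h0m ht (sub_nonneg.2 hl.2.le) hl.1.le (by ring)
      simp only [smul_eq_mul, mul_zero, zero_add, h0, zero_mul] at this ⊢
      rw [inv_mul_eq_div, le_div_iff₀ hl.1]
      linarith
    linarith
  -- Lower bound: compare with the chord from 0 to s, drop R s ≥ 0 and let s → 1, since nothing is
  -- known at 1.
  · have hlim : Tendsto (fun s : ℝ => s * (1 - R t)) (𝓝[<] 1) (𝓝 (1 * (1 - R t))) :=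
      tendsto_nhdsWithin_of_tendsto_nhds (by fun_prop : Continuous fun s : ℝ => s * (1 - R t)).continuousAt
    have : 1 * (1 - R t) ≤ t := by
      refine le_of_tendsto hlim ?_
      filter_upwards [Ioo_mem_nhdsLT ht.2] with s hs
      have hs0 : 0 < s := ht.1.trans_lt hs.1
      have hle : t / s ≤ 1 := (div_le_one hs0).2 hs.1.le
      have hts : 0 ≤ t / s := div_nonneg ht.1 hs0.le
      have := hc.2 h0m (show s ∈ Ico (0 : ℝ) 1 from ⟨hs0.le, hs.2⟩) (sub_nonneg.2 hle)
        hts (by ring)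
      simp only [smul_eq_mul, mul_zero, zero_add, h0, mul_one] at this
      rw [div_mul_cancel₀ _ hs0.ne'] at this
      have h3 : 0 ≤ t / s * R s := mul_nonneg hts (hn s ⟨hs0.le, hs.2⟩)
      have h4 : 1 - R t ≤ t / s := by linarith
      rwa [le_div_iff₀ hs0, mul_comm] at h4
    linarith

/-- For a normalized function `f` with local inverse `g` at the origin, the conformal radius along
the ray through `w` has derivative `2 Re (a₂ w)` at the origin. -/
theorem hasDerivAt_conformalRadius {f g : ℂ → ℂ} {w : ℂ} (hfa : AnalyticAt ℂ f 0)
    (hf1 : deriv f 0 = 1) (hg0 : g 0 = 0) (hg : HasDerivAt g 1 0) :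
    HasDerivAt (fun t : ℝ => (1 - ‖g (t * w)‖ ^ 2) * ‖deriv f (g (t * w))‖)
      (2 * (taylorCoeff 2 f * w).re) 0 := by
  have hlin : HasDerivAt (fun τ : ℂ => τ * w) w 0 := by
    simpa using (hasDerivAt_id (0 : ℂ)).mul_const w
  have hb : HasDerivAt (fun τ : ℂ => g (τ * w)) w ((0 : ℝ) : ℂ) := by
    have := HasDerivAt.comp (h₂ := g) (0 : ℂ) (by simpa using hg) hlin
    simpa [Function.comp_def] using this
  have hd : HasDerivAt (fun τ : ℂ => deriv f (g (τ * w))) (deriv (deriv f) 0 * w)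
      ((0 : ℝ) : ℂ) :=
    HasDerivAt.comp (h₂ := deriv f) _
      (by simpa [hg0] using hfa.deriv.differentiableAt.hasDerivAt) hb
  have hbn := (hb.comp_ofReal).norm_sq
  have hdn := (hd.comp_ofReal).norm_sq.sqrt (by simp [hg0, hf1])
  have := (hbn.const_sub 1).mul hdn
  convert! this using 1
  · ext t
    simp [Real.sqrt_sq]
  · simp [hg0, hf1, taylorCoeff, iteratedDeriv_succ, Complex.inner]
    ring

/-- If the convex image of `f` is parametrized by functions `H t` with `H t 0 = t w` that depend
affinely on `t ∈ [0, 1)`, where `w` lies outside the image, then `H t` is `f` contracted towards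
`w` by the factor `1 - t`. -/
theorem eq_contraction_of_affine_family {f : ℂ → ℂ} {w : ℂ} {H : ℝ → ℂ → ℂ}
    (hf : DifferentiableOn ℂ f (ball 0 1)) (h0 : f 0 = 0) (hconv : Convex ℝ (f '' ball 0 1))
    (ho : IsOpen (f '' ball 0 1)) (hw : w ∉ f '' ball 0 1)
    (hH : ∀ t ∈ Ico (0 : ℝ) 1, DifferentiableOn ℂ (H t) (ball 0 1) ∧
      H t '' ball 0 1 = f '' ball 0 1 ∧ H t 0 = t * w)
    (haff : ∀ s ∈ Ico (0 : ℝ) 1, ∀ l ∈ Icc (0 : ℝ) 1, ∀ z ∈ ball (0 : ℂ) 1,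
      (1 - l) * f z + l * H s z = H (l * s) z) :
    ∀ t ∈ Ico (0 : ℝ) 1, ∀ z ∈ ball (0 : ℂ) 1, H t z = (1 - t) * f z + t * w := by
  have hz : (0 : ℂ) ∈ ball (0 : ℂ) 1 := by simp
  have hhalf : (1 / 2 : ℝ) ∈ Ico (0 : ℝ) 1 := by constructor <;> norm_num
  -- The slope in t is read off at t = 1/2, because H 1 is not available; `haff` only interpolates
  -- from t = 0, hence the two cases in `hHk`.
  set k : ℂ → ℂ := fun z => 2 * (H (1 / 2) z - f z) with hk
  have hHk : ∀ t ∈ Ico (0 : ℝ) 1, ∀ z ∈ ball (0 : ℂ) 1, H t z = f z + t * k z := by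
    intro t ht z hz
    rcases le_total t (1 / 2) with h | h
    · have := haff _ hhalf (2 * t) ⟨by linarith [ht.1], by linarith⟩ z hz
      rw [show 2 * t * (1 / 2) = t by ring] at this
      rw [← this, hk]
      push_cast
      ring
    · have ht0 : 0 < t := by linarith
      have := haff t ht (1 / (2 * t)) ⟨by positivity, by
        rw [div_le_one (by positivity)]; linarith⟩ z hz
      rw [show 1 / (2 * t) * t = 1 / 2 by field_simp] at this
      have ht' : (t : ℂ) ≠ 0 := by exact_mod_cast ht0.ne'
      rw [hk]
      simp only [← this]
      push_cast
      field_simp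
      ring
  obtain ⟨L, hL⟩ := geometric_hahn_banach_open_point hconv ho hw
  have hle : ∀ z ∈ ball (0 : ℂ) 1, L (f z + k z) ≤ L w := by
    intro z hz
    have hlim : Tendsto (fun t : ℝ => L (f z + t * k z)) (𝓝[<] 1)
        (𝓝 (L (f z + ((1 : ℝ) : ℂ) * k z))) :=
      tendsto_nhdsWithin_of_tendsto_nhds
        (by fun_prop : Continuous fun t : ℝ => L (f z + t * k z)).continuousAt
    rw [Complex.ofReal_one, one_mul] at hlim
    refine le_of_tendsto hlim ?_
    filter_upwards [Ioo_mem_nhdsLT (zero_lt_one (α := ℝ))] with t ht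
    have ht' : t ∈ Ico (0 : ℝ) 1 := ⟨ht.1.le, ht.2⟩
    rw [← hHk t ht' z hz]
    exact (hL _ ((hH t ht').2.1 ▸ mem_image_of_mem _ hz)).le
  have hk0 : f 0 + k 0 = w := by
    rw [hk]
    simp only [h0, (hH _ hhalf).2.2]
    push_cast
    ring
  have hd : AnalyticOnNhd ℂ (fun z => f z + k z) (ball 0 1) :=
    (hf.add (((hH _ hhalf).1.sub hf).const_mul 2)).analyticOnNhd isOpen_ball
  have hconst : ∀ z ∈ ball (0 : ℂ) 1, f z + k z = w := by
    rcases hd.is_constant_or_isOpen (convex_ball 0 1).isPreconnected with ⟨c, hc⟩ | hop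
    · intro z hz'
      rw [hc z hz', ← hk0, hc 0 hz]
    · exfalso
      have hopen := hop _ subset_rfl isOpen_ball
      have hwm : w ∈ (fun z => f z + k z) '' ball 0 1 := ⟨0, hz, hk0⟩
      have hLw : 0 < L w := by simpa [h0] using hL (f 0) (mem_image_of_mem f hz)
      have hcont : ContinuousAt (fun s : ℝ => (s : ℂ) * w) 1 := by fun_prop
      -- An open image would contain s w for some s > 1, beyond the supporting line because L w > L
      -- 0 = 0.
      have hev : ∀ᶠ s : ℝ in 𝓝[>] 1, (s : ℂ) * w ∈ (fun z => f z + k z) '' ball 0 1 :=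
        (hcont.eventually_mem (by rw [Complex.ofReal_one, one_mul]; exact hopen.mem_nhds hwm)).filter_mono
          nhdsWithin_le_nhds
      obtain ⟨s, ⟨z, hz', hs⟩, hs1⟩ := (hev.and self_mem_nhdsWithin).exists
      have h1 := hle z hz'
      simp only at hs
      rw [hs, ← Complex.real_smul, map_smul, smul_eq_mul] at h1
      nlinarith
  intro t ht z hz
  rw [hHk t ht z hz, ← hconst z hz]
  ring

/-! ### The main theorem -/

theorem theorem2p1 (f : ℂ → ℂ) (hf : IsNormalizedConvexMapping f)
    (ζ : ℂ) (hζ : ζ ∈ Metric.sphere (0 : ℂ) 1)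
    (w : ℂ) (hw : HasFiniteBoundaryValue f ζ w)
    (heq : (taylorCoeff 2 f * w).re = -1 / 2) :
    IsOpenHalfplane (f '' Metric.ball 0 1) ∨
      IsInfiniteConvexSector (f '' Metric.ball 0 1) := by
  obtain ⟨hfd, hfi, hf0, hf1, hconv⟩ := hf
  obtain ⟨ho, g, hgl, hg⟩ := exists_inverse_of_univalent hfd hfi
  have hz : (0 : ℂ) ∈ ball (0 : ℂ) 1 := by simp
  have h0m : (0 : ℝ) ∈ Ico (0 : ℝ) 1 := by simp
  have h0Ω : (0 : ℂ) ∈ f '' ball 0 1 := ⟨0, hz, hf0⟩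
  have hwn := boundary_value_notMem_image hfd hfi hζ hw
  have hwc := boundary_value_mem_closure_image hζ hw
  have hray : ∀ t ∈ Ico (0 : ℝ) 1, (t : ℂ) * w ∈ f '' ball 0 1 := by
    intro t ht
    have := hconv.combo_interior_closure_mem_interior (ho.interior_eq.symm ▸ h0Ω) hwc
      (sub_pos.2 ht.2) ht.1 (by ring)
    simpa [ho.interior_eq] using this
  have hgray : ∀ t ∈ Ico (0 : ℝ) 1, g (t * w) ∈ ball (0 : ℂ) 1 ∧ f (g (t * w)) = t * w := by
    intro t ht
    obtain ⟨x, hx, h⟩ := hray t ht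
    rw [← h, hgl x hx]
    exact ⟨hx, rfl⟩
  have hg0 : g 0 = 0 := by simpa [hf0] using hgl 0 hz
  set R : ℝ → ℝ := fun t => (1 - ‖g (t * w)‖ ^ 2) * ‖deriv f (g (t * w))‖ with hR
  have hR0 : R 0 = 1 := by simp [hR, hg0, hf1]
  have hRn : ∀ t ∈ Ico (0 : ℝ) 1, 0 ≤ R t := by
    intro t ht
    have := mem_ball_zero_iff.1 (hgray t ht).1
    exact mul_nonneg (by nlinarith [norm_nonneg (g (t * w))]) (norm_nonneg _)
  have hRd : HasDerivAt R (-1) 0 := by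
    have := hasDerivAt_conformalRadius (w := w)
      (hfd.analyticAt (isOpen_ball.mem_nhds hz)) hf1 hg0 (by simpa [hf0, hf1] using (hg 0 hz).2)
    rwa [heq, show (2 : ℝ) * (-1 / 2) = -1 by norm_num] at this
  choose! H hHd hHi hHim hH0 hH1 using fun t (ht : t ∈ Ico (0 : ℝ) 1) =>
    exists_koebe_transform hfd hfi (hgray t ht).1
  have hH0' : ∀ t ∈ Ico (0 : ℝ) 1, H t 0 = t * w := fun t ht => (hH0 t ht).trans (hgray t ht).2
  have hmem : ∀ x ∈ Ico (0 : ℝ) 1, ∀ y ∈ Ico (0 : ℝ) 1, ∀ a b : ℝ, 0 ≤ a → 0 ≤ b → a + b = 1 →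
      a * x + b * y ∈ Ico (0 : ℝ) 1 := fun x hx y hy a b ha hb hab =>
    convex_Ico (𝕜 := ℝ) (0 : ℝ) 1 hx hy ha hb hab
  have hcomb : ∀ x ∈ Ico (0 : ℝ) 1, ∀ y ∈ Ico (0 : ℝ) 1, ∀ a b : ℝ, 0 ≤ a → 0 ≤ b →
      a + b = 1 → a * R x + b * R y ≤ R (a * x + b * y) ∧
      (a * R x + b * R y = R (a * x + b * y) →
        ∀ z ∈ ball (0 : ℂ) 1, a * H x z + b * H y z = H (a * x + b * y) z) := by
    intro x hx y hy a b ha hb hab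
    have hxy := hmem x hx y hy a b ha hb hab
    have hder : deriv (fun z => a * H x z + b * H y z) 0 = ((a * R x + b * R y : ℝ) : ℂ) := by
      have hx' := ((hHd x hx).differentiableAt (isOpen_ball.mem_nhds hz)).hasDerivAt.const_mul
        (a : ℂ)
      have hy' := ((hHd y hy).differentiableAt (isOpen_ball.mem_nhds hz)).hasDerivAt.const_mul
        (b : ℂ)
      refine (hx'.add hy').deriv.trans ?_
      rw [hH1 x hx, hH1 y hy]
      simp only [hR]
      push_cast
      rfl
    have hs := subordinate_schwarz (G := fun z => a * H x z + b * H y z) (hHd _ hxy) (hHi _ hxy)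
      (((hHd x hx).const_mul _).add ((hHd y hy).const_mul _)) ?_ ?_
    · have hRxy : deriv (H (a * x + b * y)) 0 = (R (a * x + b * y) : ℂ) := hH1 _ hxy
      rw [hder, hRxy, Complex.norm_real, Complex.norm_real, Real.norm_of_nonneg (hRn _ hxy)] at hs
      exact ⟨(le_abs_self _).trans hs.1, fun h => hs.2 (by rw [h])⟩
    · intro z hz
      rw [hHim _ hxy]
      have := hconv (hHim x hx ▸ mem_image_of_mem (H x) hz)
        (hHim y hy ▸ mem_image_of_mem (H y) hz) ha hb hab
      simpa using this
    · simp only [hH0' _ hxy, hH0' x hx, hH0' y hy]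
      push_cast
      ring
  have hRt := eq_one_sub_of_concaveOn
    ⟨convex_Ico 0 1, fun x hx y hy a b ha hb hab => (hcomb x hx y hy a b ha hb hab).1⟩
    hRn hR0 hRd
  -- The transform at t = 0 has the same value and derivative at 0 as f, so the equality case of
  -- Schwarz applies.
  have hHf : ∀ z ∈ ball (0 : ℂ) 1, H 0 z = f z := by
    refine (subordinate_schwarz hfd hfi (hHd 0 h0m) ?_ ?_).2 ?_
    · rw [← hHim 0 h0m]; exact mapsTo_image _ _
    · rw [hH0' 0 h0m, hf0]; simp
    · have := hH1 0 h0m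
      rw [this, hf1]
      exact_mod_cast hR0
  have hcone := eq_contraction_of_affine_family hfd hf0 hconv ho hwn
    (fun t ht => ⟨hHd t ht, hHim t ht, hH0' t ht⟩) (by
      intro s hs l hl z hz
      have hm := hmem 0 h0m s hs (1 - l) l (sub_nonneg.2 hl.2) hl.1 (by ring)
      have := (hcomb 0 h0m s hs (1 - l) l (sub_nonneg.2 hl.2) hl.1 (by ring)).2
        (by rw [hRt 0 h0m, hRt s hs, hRt _ hm]; ring) z hz
      rw [hHf z hz] at this
      simpa using this)
  have hcontract : ∀ x ∈ f '' ball 0 1, ∀ t ∈ Ico (0 : ℝ) 1, (1 - t) * x + t * w ∈ f '' ball 0 1 := by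
    rintro _ ⟨z, hz, rfl⟩ t ht
    rw [← hcone t ht z hz, ← hHim t ht]
    exact mem_image_of_mem _ hz
  have hexpand : ∀ y ∈ f '' ball 0 1, ∀ t ∈ Ico (0 : ℝ) 1,
      ∃ x ∈ f '' ball 0 1, y = (1 - t) * x + t * w := by
    intro y hy t ht
    rw [← hHim t ht] at hy
    obtain ⟨z, hz, rfl⟩ := hy
    exact ⟨f z, mem_image_of_mem f hz, hcone t ht z hz⟩
  refine isOpenHalfplane_or_isInfiniteConvexSector ho hconv ⟨0, h0Ω⟩ hwn fun x hx r hr => ?_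
  -- Factors r ≤ 1 are contractions with t = 1 - r; factors r ≥ 1 invert the contraction by 1/r,
  -- which maps Ω onto itself.
  rcases le_total r 1 with h | h
  · convert hcontract x hx (1 - r) ⟨by linarith, by linarith⟩ using 1
    push_cast
    ring
  · obtain ⟨y, hy, hxy⟩ := hexpand x hx (1 - r⁻¹)
      ⟨sub_nonneg.2 (inv_le_one_of_one_le₀ h), by linarith [inv_pos.2 hr]⟩
    have hr' : (r : ℂ) ≠ 0 := by exact_mod_cast hr.ne'
    convert hy using 1
    rw [hxy]
    push_cast
    field_simp
    ring
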